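/- **Setting.** Let $G=\mathbb Z$ (discrete theory) or $G=\mathbb R$ (continuous theory); coefficients are complex. Write $\ell_0=\log x$, $\ell_{i+1}=\log \ell_i$, and for a finitely supported integer sequence $\alpha=(\alpha_0,\alpha_1,\dots)$ put $\ell^\alpha=\prod_i \ell_i^{\alpha_i}$; $(0)$ is the zero sequence. The iterated logarithmic algebra $\mathcal I$ consists of the formal series $\sum c_{b,\beta}x^b\ell^\beta$ ($b\in\mathbb R$) with Noetherian support for the lexicographic order of $(b,\beta_0,\beta_1,\dots)$ (every nonempty set of occurring monomials has a largest one). The Roman factorial is $\lfloor a\rceil!=\Gamma(a+1)$ if $a$ is not a negative integer, and $\lfloor -m-1\rceil!=(-1)^m/m!$ for $m\in\mathbb N$. With $\theta=x\,\frac{d}{dx}$, the harmonic logarithm of degree $a$ and order $\alpha$ is $$\lambda_a^\alpha(x)=x^a\sum_{k\ge0}\gamma_k(a)\,\theta^k\ell^\alpha,\qquad \sum_{k\ge 0}\gamma_k(a)y^k=\lfloor a\rceil!\,\frac{\Gamma(1+y)}{\Gamma(1+a+y)} ,$$ so that $\lambda_0^\alpha=\ell^\alpha$ and $\frac{d}{dx}\lambda_a^\alpha=\frac{\lfloor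 a\rceil!}{\lfloor a-1\rceil!}\lambda_{a-1}^\alpha$, while $\lambda_a^{(0)}=x^a$, or $0$ if $a$ is a negative integer. $\mathcal I^\alpha$ is the space of the convergent series $\sum_a c_a\lambda_a^\alpha$ (Noetherian support in $a$), and $\langle\cdot\rangle_\alpha$ denotes the coefficient of $\lambda_0^\alpha$ in such a series. An Artinian operator is a series $f(D)=\sum_s f_sD^s$ with well-ordered support in $G$. It acts on $\mathcal I^\alpha$, $\alpha\ne(0)$, by the continuous extension of $D^s\lambda_a^\alpha=\frac{\lfloor a\rceil!}{\lfloor a-s\rceil!}\lambda_{a-s}^\alpha$; if $f(D)$ is a differential operator (a power series in $D$), it acts in the same way on $\mathcal I^{(0)}$. Its Pincherle derivative is $f'(D)=\sum_s s f_sD^{s-1}$. It is a delta operator if its least exponent is $1$. If $f(D)=cD(1+g(D))$ with $c\neq0$ is a delta operator, then for $b\in G$, $n\in\mathbb Z$, $$f(D)^{b;n}=e^{b(\operatorname{Log}c+2\pi i n)}\,D^b\sum_{k\ge0}\binom bk g(D)^k$$ (the ordinary power $f(D)^b$ when $b\in\mathbb Z$). A graded sequence is a family $p_a^\alpha(x)=\sum_b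 c_{ab}\lambda_b^\alpha(x)\in\mathcal I^\alpha$, indexed by $a\in G$ and all orders $\alpha$, with exponents $b\in G$, with largest exponent $b=a$, and with coefficients $c_{ab}$ not depending on $\alpha$. It is the ($n$-th) associated graded sequence of $f(D)$ if $$\langle f(D)^{b;n}p_a^\alpha(x)\rangle_\alpha=\lfloor a\rceil!\,\delta_{ab}\qquad\text{for all }a,b\in G,\ \alpha\neq(0).$$ The standard Roman shift $\sigma$ is the linear operator, continuous on each $\mathcal I^\alpha$, with $\sigma\lambda_a^\alpha=\lambda_{a+1}^\alpha$ for $a\ne-1$ and $\sigma\lambda_{-1}^\alpha=0$. **Theorem (Recurrence Formula).** Let $f(D)$ be a delta operator, $n\in\mathbb Z$, and let $(p_a^\alpha)$ be an ($n$-th) associated graded sequence of $f(D)$. Then for all $a\in G$ with $a\ne-1$ and all $\alpha$, $$p_{a+1}^\alpha(x)=\sigma\,(f'(D))^{-1}\,p_a^\alpha(x),$$ where, for $\alpha=(0)$ in the continuous theory, $f(D)$ is assumed to be a differential operator, so that $(f'(D))^{-1}$ acts on $\mathcal I^{(0)}$ (in the discrete theory every delta operator is one). -/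

import Mathlib

noncomputable section

namespace IterLog

open Finset

/-! ### Roman factorials -/

/-- `a` is a negative integer. -/
def IsNegInt (a : ℝ) : Prop := ∃ m : ℕ, a = -((m : ℝ) + 1)

open Classical in
/-- The Roman factorial `⌊a⌉!`: it is `Γ(a + 1)` when `a` is not a negative integer, and
`(-1)^m / m!` when `a = -(m + 1)` with `m : ℕ`. -/
def romanFactorial (a : ℝ) : ℝ :=
  if h : IsNegInt a then (-1) ^ h.choose / (h.choose.factorial : ℝ) else Real.Gamma (a + 1)

/-! ### The iterated logarithmic algebra

Write `ℓ₀ = log x`, `ℓ₁ = log log x`, `ℓ₂ = log log log x`, and so on. -/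

/-- An order: a finitely supported sequence `α` of integers. It stands for the monomial
`ℓ^α = ℓ₀^(α 0) ℓ₁^(α 1) ⋯` in the iterated logarithms. -/
abbrev LogOrder := ℕ →₀ ℤ

/-- The monomials `x^b ℓ^β`, `b` real, in the reverse of the order of growth at infinity (which is
lexicographic in `b, β 0, β 1, …`). -/
abbrev LogMonomial := ℝᵒᵈ ×ₗ (Lex LogOrder)ᵒᵈ

/-- The monomial `x^b ℓ^β`. -/
def mono (b : ℝ) (β : LogOrder) : LogMonomial :=
  toLex (OrderDual.toDual b, OrderDual.toDual (toLex β))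

/-- The exponent of `x` in a monomial. -/
def xExp (m : LogMonomial) : ℝ := OrderDual.ofDual (ofLex m).1

/-- The exponents of the iterated logarithms in a monomial. -/
def logExp (m : LogMonomial) : LogOrder := ofLex (OrderDual.ofDual (ofLex m).2)

/-- The (continuous) iterated logarithmic algebra `𝓘`: Noetherian formal series
`∑ c_{b,β} x^b ℓ^β`, that is, every nonempty set of monomials of the series has a largest one. -/
abbrev LogSeries := HahnSeries LogMonomial ℂ

/-! ### Harmonic logarithms -/

/-- `x d/dx` of the monomial `ℓ^α`. As `x d/dx ℓ_i = (ℓ₀ ℓ₁ ⋯ ℓ_{i-1})⁻¹`, it equals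
`∑ i, α i • ℓ^α / (ℓ₀ ⋯ ℓ_i)`. -/
def thetaMono (α : LogOrder) : LogOrder →₀ ℂ :=
  ∑ i ∈ α.support,
    Finsupp.single (α - ∑ j ∈ range (i + 1), Finsupp.single j (1 : ℤ)) ((α i : ℤ) : ℂ)

/-- The operator `θ = x d/dx` on Laurent polynomials in the iterated logarithms. -/
def theta : Module.End ℂ (LogOrder →₀ ℂ) := Finsupp.linearCombination ℂ thetaMono

/-- The `k`-th Taylor coefficient at `y = 0` of `⌊a⌉! Γ(1 + y) / Γ(1 + a + y)`
(`1 / Γ` is entire, and Mathlib's `Γ⁻¹` is this entire function). -/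
def harmonicCoeff (a : ℝ) (k : ℕ) : ℂ :=
  (romanFactorial a : ℂ) *
    (iteratedDeriv k (fun y : ℂ => Complex.Gamma (1 + y) * (Complex.Gamma (1 + a + y))⁻¹) 0 /
      (k.factorial : ℂ))

theorem theta_pow_apply_ne_zero (α : LogOrder) (k : ℕ) (β : LogOrder)
    (h : (theta ^ k) (Finsupp.single α 1) β ≠ 0) : β 0 = α 0 - k := by
  induction k generalizing β with
  | zero =>
    simp only [pow_zero, Module.End.one_apply, Finsupp.single_apply] at h
    have : α = β := by by_contra hne; simp [hne] at h
    simp [this]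
  | succ k ih =>
    rw [pow_succ', Module.End.mul_apply, theta, Finsupp.linearCombination_apply, Finsupp.sum,
      Finsupp.finsetSum_apply] at h
    obtain ⟨γ, hγ, h1⟩ := Finset.exists_ne_zero_of_sum_ne_zero h
    have h2 := ih γ (Finsupp.mem_support_iff.1 hγ)
    rw [Finsupp.smul_apply, thetaMono, Finsupp.finsetSum_apply] at h1
    have h3 := right_ne_zero_of_smul h1
    obtain ⟨i, -, h4⟩ := Finset.exists_ne_zero_of_sum_ne_zero h3
    rw [Finsupp.single_apply] at h4
    have h5 : γ - ∑ j ∈ range (i + 1), Finsupp.single j (1 : ℤ) = β := by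
      by_contra hne; simp [hne] at h4
    rw [← h5, Finsupp.sub_apply, Finsupp.finsetSum_apply, h2, Finset.sum_eq_single 0]
    · simp; ring
    · intro j _ hj; simp [hj]
    · simp

/-- The coefficient of `x^b ℓ^β` in the harmonic logarithm of degree `b` and order `α`.
Every application of `θ` lowers the exponent of `ℓ₀` by one, so in `∑ k, harmonicCoeff b k • θ^k ℓ^α`
only `k = α 0 - β 0` contributes to `ℓ^β`. -/
def harmonicEntry (b : ℝ) (α β : LogOrder) : ℂ :=
  harmonicCoeff b (α 0 - β 0).toNat *
    (theta ^ (α 0 - β 0).toNat) (Finsupp.single α 1) β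

theorem isPWO_harmonicEntry (α : LogOrder) :
    {β : (Lex LogOrder)ᵒᵈ | ∃ b, harmonicEntry b α (ofLex (OrderDual.ofDual β)) ≠ 0}.IsPWO := by
  have key : ∀ β : (Lex LogOrder)ᵒᵈ,
      (∃ b, harmonicEntry b α (ofLex (OrderDual.ofDual β)) ≠ 0) → ∃ k : ℕ,
      ofLex (OrderDual.ofDual β) 0 = α 0 - k ∧
      ofLex (OrderDual.ofDual β) ∈ ((theta ^ k) (Finsupp.single α 1)).support := by
    rintro β ⟨b, hb⟩
    have h := right_ne_zero_of_mul hb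
    exact ⟨_, theta_pow_apply_ne_zero _ _ _ h, Finsupp.mem_support_iff.2 h⟩
  rw [Set.IsPWO, Set.partiallyWellOrderedOn_iff_exists_lt]
  intro f hf
  choose k hk0 hk1 using fun n => key (f n) (hf n)
  by_cases hc : ∃ n, k 0 < k n
  · obtain ⟨n, hn⟩ := hc
    have hn0 : 0 < n := by
      rcases Nat.eq_zero_or_pos n with rfl | h
      · exact absurd hn (lt_irrefl _)
      · exact h
    refine ⟨0, n, hn0, ?_⟩
    have : OrderDual.ofDual (f n) < OrderDual.ofDual (f 0) := by
      rw [Finsupp.Lex.lt_iff]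
      refine ⟨0, fun j hj => absurd hj (Nat.not_lt_zero _), ?_⟩
      have e1 := hk0 n
      have e2 := hk0 0
      have e3 : ((k 0 : ℕ) : ℤ) < k n := by exact_mod_cast hn
      change ofLex (OrderDual.ofDual (f n)) 0 < ofLex (OrderDual.ofDual (f 0)) 0
      omega
    exact this.le
  · push Not at hc
    have hfin : (⋃ j ∈ (Finset.range (k 0 + 1) : Set ℕ),
        {β : (Lex LogOrder)ᵒᵈ | ofLex (OrderDual.ofDual β) ∈
          ((theta ^ j) (Finsupp.single α 1)).support}).Finite := by
      refine Set.Finite.biUnion (Finset.finite_toSet _) fun j _ => ?_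
      refine Set.Finite.preimage ?_ (Finset.finite_toSet _)
      intro x _ y _ hxy
      exact hxy
    have hp := hfin.isPWO
    rw [Set.IsPWO, Set.partiallyWellOrderedOn_iff_exists_lt] at hp
    refine hp f fun n => ?_
    simp only [Set.mem_iUnion]
    refine ⟨k n, ?_, hk1 n⟩
    have := hc n
    simpa using Nat.lt_succ_of_le this

/-- Noetherian series `∑ c_a (·)_a` in one real degree: every nonempty set of degrees that occur has
a largest element. `c.coeff (toDual a)` is the coefficient in degree `a`. -/
abbrev Noeth := HahnSeries ℝᵒᵈ ℂ

/-- The convergent series `∑ a, c_a λ_a^α` of harmonic logarithms of order `α`. As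
`λ_a^α = x^a ∑ k, harmonicCoeff a k • θ^k ℓ^α`, only `λ_b^α` contributes to `x^b ℓ^β`. -/
def harmonicSum (α : LogOrder) (c : Noeth) : LogSeries where
  coeff m := c.coeff (OrderDual.toDual (xExp m)) * harmonicEntry (xExp m) α (logExp m)
  isPWO_support' := by
    refine Set.PartiallyWellOrderedOn.subsetProdLex ?_ fun a => ?_
    · refine c.isPWO_support.mono ?_
      rintro _ ⟨m, hm, rfl⟩
      exact left_ne_zero_of_mul hm
    · refine (isPWO_harmonicEntry α).mono ?_
      intro β hβ
      exact ⟨OrderDual.ofDual a, right_ne_zero_of_mul hβ⟩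

/-- The harmonic logarithm of degree `a` and order `α`,
`λ_a^α = ⌊a⌉! x^a [Γ(1 + θ) / Γ(1 + a + θ)] ℓ^α` with `θ = x d/dx`.
Thus `λ_0^α = ℓ^α`, `(d/dx) λ_a^α = (⌊a⌉! / ⌊a - 1⌉!) λ_{a-1}^α`, `λ_a^(0) = x^a` when `a` is not a
negative integer, and `λ_a^(0) = 0` when it is. -/
def harmonicLog (a : ℝ) (α : LogOrder) : LogSeries :=
  harmonicSum α (HahnSeries.single (OrderDual.toDual a) 1)

/-- The space `𝓘^α` of all convergent series `∑ a, c_a λ_a^α`. -/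
def logSpace (α : LogOrder) : Set LogSeries := Set.range (harmonicSum α)

/-- `p = ∑ a, c_a λ_a^α`, where for `α = (0)` the vanishing `λ_a^(0)`, `a` a negative integer, get
the coefficient zero. -/
def IsExpansion (α : LogOrder) (p : LogSeries) (c : Noeth) : Prop :=
  p = harmonicSum α c ∧ (α = 0 → ∀ a : ℝ, IsNegInt a → c.coeff (OrderDual.toDual a) = 0)

open Classical in
/-- The coefficients of `p ∈ 𝓘^α` in the basis of harmonic logarithms of order `α`
(and zero, by convention, when `p ∉ 𝓘^α`). -/
def expansion (α : LogOrder) (p : LogSeries) : Noeth :=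
  if h : ∃ c, IsExpansion α p c then h.choose else 0

/-- The augmentation `⟨p⟩_α` of `p ∈ 𝓘^α`: the coefficient of `λ_0^α = ℓ^α`. -/
def augmentation (α : LogOrder) (p : LogSeries) : ℂ := p.coeff (mono 0 α)

/-! ### Artinian operators -/

/-- Artinian operators `f(D) = ∑ s, f_s D^s`, `s` real, with well-ordered support; the product
is the product of series, and the nonzero operators form a group. -/
abbrev ArtinianOp := HahnSeries ℝ ℂ

/-- `f(D)` is a differential operator: a power series in `D`. -/
def IsDifferential (f : ArtinianOp) : Prop := ∀ s ∈ f.support, ∃ k : ℕ, s = k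

/-- `f(D)` is a delta operator: its degree (the least exponent that occurs) is one. -/
def IsDelta (f : ArtinianOp) : Prop := f.orderTop = ((1 : ℝ) : WithTop ℝ)

/-- The action of `f(D)` on coefficients with respect to the harmonic logarithms: the continuous
bilinear extension of `D^s λ_a^α = (⌊a⌉! / ⌊a - s⌉!) λ_{a-s}^α`. -/
def actCoeff (f : ArtinianOp) (c : Noeth) : Noeth where
  coeff b := ∑ᶠ s : ℝ, f.coeff s * c.coeff (OrderDual.toDual (OrderDual.ofDual b + s)) *
    ((romanFactorial (OrderDual.ofDual b + s) / romanFactorial (OrderDual.ofDual b) : ℝ) : ℂ)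
  isPWO_support' := by
    have h1 : ((fun s : ℝ => OrderDual.toDual (-s)) '' f.support).IsPWO :=
      f.isPWO_support.image_of_monotone fun s t h => by
        exact OrderDual.toDual_le_toDual.2 (neg_le_neg h)
    refine (h1.add c.isPWO_support).mono ?_
    intro b hb
    obtain ⟨s, hs⟩ : ∃ s : ℝ, f.coeff s *
        c.coeff (OrderDual.toDual (OrderDual.ofDual b + s)) *
        ((romanFactorial (OrderDual.ofDual b + s) / romanFactorial (OrderDual.ofDual b) : ℝ) : ℂ)
          ≠ 0 := by
      by_contra! hall
      exact hb ((finsum_congr hall).trans finsum_zero)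
    have hs' := left_ne_zero_of_mul hs
    refine Set.mem_add.2 ⟨_, ⟨s, left_ne_zero_of_mul hs', rfl⟩, _, right_ne_zero_of_mul hs', ?_⟩
    apply OrderDual.ofDual.injective
    simp only [ofDual_add, OrderDual.ofDual_toDual]
    ring

/-- The action of the Artinian operator `f(D)` on `𝓘^α`, for `α ≠ (0)`, and of the differential
operator `f(D)` on `𝓘^(0)`. -/
def act (α : LogOrder) (f : ArtinianOp) (p : LogSeries) : LogSeries :=
  harmonicSum α (actCoeff f (expansion α p))

/-- The Pincherle derivative `f'(D) = ∑ s, s f_s D^(s-1)`. -/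
def pincherle (f : ArtinianOp) : ArtinianOp where
  coeff s := ((s + 1 : ℝ) : ℂ) * f.coeff (s + 1)
  isPWO_support' := by
    have h1 : ((fun s : ℝ => s - 1) '' f.support).IsPWO :=
      f.isPWO_support.image_of_monotone fun s t h => sub_le_sub_right h 1
    refine h1.mono ?_
    intro s hs
    exact ⟨s + 1, right_ne_zero_of_mul hs, by simp⟩

/-- The power `f(D)^{b;n}`, `b` real: if `f(D) = c D^d (1 + g(D))` with `c ≠ 0` and all exponents in
`g(D)` positive, it is `c^{b;n} D^(bd) ∑ k, (b choose k) g(D)^k`, where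
`c^{b;n} = exp (b (log c + 2πin))` with the principal logarithm. For an integer `b`, it is the usual
power `f(D)^b`, whatever `n` is. -/
def genPow (f : ArtinianOp) (b : ℝ) (n : ℤ) : ArtinianOp :=
  HahnSeries.single (b * f.order)
      (Complex.exp (b * (Complex.log f.leadingCoeff + 2 * Real.pi * Complex.I * n))) *
    (HahnSeries.SummableFamily.binomialFamily
      (HahnSeries.single (-f.order) f.leadingCoeff⁻¹ * f) (b : ℂ)).hsum

/-! ### The standard Roman shift -/

/-- The standard Roman shift on coefficients: `λ_a^α ↦ λ_{a+1}^α` for `a ≠ -1`, and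
`λ_{-1}^α ↦ 0`. -/
def shiftCoeff (c : Noeth) : Noeth where
  coeff b := if OrderDual.ofDual b = 0 then 0
    else c.coeff (OrderDual.toDual (OrderDual.ofDual b - 1))
  isPWO_support' := by
    have h1 : ((fun b : ℝᵒᵈ => OrderDual.toDual (OrderDual.ofDual b + 1)) '' c.support).IsPWO :=
      c.isPWO_support.image_of_monotone fun s t h => by
        exact OrderDual.toDual_le_toDual.2 (by
          have : OrderDual.ofDual t ≤ OrderDual.ofDual s := h
          linarith)
    refine h1.mono ?_
    intro b hb
    refine ⟨OrderDual.toDual (OrderDual.ofDual b - 1), ?_, by simp⟩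
    intro h0
    apply hb
    simp only at h0 ⊢
    split_ifs
    · rfl
    · exact h0

/-- The standard Roman shift `σ` on `𝓘^α`: the continuous linear map with
`σ λ_a^α = λ_{a+1}^α` for `a ≠ -1` and `σ λ_{-1}^α = 0`. -/
def romanShift (α : LogOrder) (p : LogSeries) : LogSeries :=
  harmonicSum α (shiftCoeff (expansion α p))

/-! ### Graded sequences -/

/-- A graded sequence `p_a^α`, with degrees `a` in the group `G` of exponents (`ℤ` in the discrete
theory, `ℝ` in the continuous theory): `p_a^α = ∑ b, c_{ab} λ_b^α`, a convergent series with
exponents in `G`, of degree `a`, whose coefficients `c_{ab}` do not depend on the order `α`. -/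
def IsGraded (G : AddSubgroup ℝ) (p : ℝ → LogOrder → LogSeries) : Prop :=
  ∀ a ∈ G, ∃ c : Noeth, (∀ b ∈ c.support, OrderDual.ofDual b ∈ G) ∧
    c.orderTop = ((OrderDual.toDual a : ℝᵒᵈ) : WithTop ℝᵒᵈ) ∧ ∀ α : LogOrder, p a α = harmonicSum α c

/-- `p` is the (`n`-th) associated graded sequence of the delta operator `f(D)`:
`⟨f(D)^{b;n} p_a^α⟩_α = ⌊a⌉! δ_{ab}` for all degrees `a, b` and all orders `α ≠ (0)`. -/
def IsAssociated (G : AddSubgroup ℝ) (f : ArtinianOp) (n : ℤ)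
    (p : ℝ → LogOrder → LogSeries) : Prop :=
  IsGraded G p ∧ ∀ a ∈ G, ∀ b ∈ G, ∀ α : LogOrder, α ≠ 0 →
    augmentation α (act α (genPow f b n) (p a α)) =
      if a = b then (romanFactorial a : ℂ) else 0

end IterLog

end

noncomputable section

namespace IterLog

open HahnSeries

/-! ### The Euler operator and powers of delta operators -/

/-! Encode a series `∑ c_a λ_a^α` as the series `∑ c_a ⌊a⌉! T^(-a)` (`toOp`). The factorial
quotients in the action of `D^s` are then absorbed, so an Artinian operator acts by multiplication,
the augmentation becomes the coefficient of `T^0`, and the Roman shift becomes `x ↦ -E (T⁻¹ x)` with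
`E = T d/dT`.

A residue argument finds the associated sequence. For `b ≠ -1`, `f^b E f` is `E (f^(b+1))` divided
by `b + 1`, so it has no constant term; for `b = -1` its constant term is the order of `f`, namely
1. Hence `⌊a⌉! f^(-a-1) E f` satisfies the defining conditions on `p_a`. It is the only such series
with exponents in `G`, because the constant terms of all `f^b x` determine `x`
(`toOp_eq_of_forall_coeff_zero`).

Since `E f = T f'`, dividing by `f'` and by `T` leaves `⌊a⌉! f^(-a-1)`. Applying `-E` gives `(a + 1)
⌊a⌉! f^(-a-2) E f`, which is the encoding of `p_(a+1)` because `⌊a+1⌉! = (a + 1) ⌊a⌉!` for `a ≠ -1`.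

For `α = (0)` the encoding is ambiguous, as `λ_a^(0) = 0` at negative integers `a`. The differential
operator and the shift must be shown not to see this ambiguity (`act_harmonicSum`,
`romanShift_harmonicSum`). -/

/-- The Euler operator `T d/dT`. -/
def euler (f : ArtinianOp) : ArtinianOp where
  coeff s := (s : ℂ) * f.coeff s
  isPWO_support' := f.isPWO_support.mono fun _ hs => right_ne_zero_of_mul hs

@[simp] theorem coeff_euler (f : ArtinianOp) (s : ℝ) :
    (euler f).coeff s = (s : ℂ) * f.coeff s := rfl

theorem support_euler_subset (f : ArtinianOp) : (euler f).support ⊆ f.support :=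
  fun _ hs => right_ne_zero_of_mul hs

theorem euler_sub_one (f : ArtinianOp) : euler f = euler (f - 1) := by
  ext s
  by_cases h : s = 0 <;> simp [HahnSeries.coeff_one, h]

theorem euler_single (b : ℝ) (c : ℂ) : euler (single b c) = (b : ℂ) • single b c := by
  ext s
  by_cases h : s = b
  · subst h; simp
  · simp [coeff_single_of_ne h]

theorem euler_mul (f g : ArtinianOp) : euler (f * g) = euler f * g + f * euler g := by
  ext s
  rw [coeff_euler, coeff_add, coeff_mul,
    coeff_mul_left' f.isPWO_support (support_euler_subset f),
    coeff_mul_right' g.isPWO_support (support_euler_subset g), Finset.mul_sum,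
    ← Finset.sum_add_distrib]
  refine Finset.sum_congr rfl fun ij hij => ?_
  rw [← (Finset.mem_antidiagonal.1 hij).2.2]
  simp only [coeff_euler]
  push_cast
  ring

theorem euler_pow (g : ArtinianOp) (k : ℕ) :
    euler (g ^ (k + 1)) = ((k : ℂ) + 1) • (euler g * g ^ k) := by
  induction k with
  | zero => simp
  | succ k ih =>
    rw [pow_succ, euler_mul, ih, pow_succ]
    simp only [← C_mul_eq_smul]
    push_cast
    simp only [map_add, map_one]
    ring

/-- The chain rule, obtained termwise from `euler_pow`. -/
theorem euler_heval (g : ArtinianOp) (hg : 0 < g.orderTop) (φ : PowerSeries ℂ) :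
    euler (PowerSeries.heval g φ) =
      euler g * PowerSeries.heval g (PowerSeries.derivative ℂ φ) := by
  -- `E` kills the constant term `k = 0`, so the family of images is the derivative's family shifted
  -- by one index.
  have key : ∀ k : ℕ, euler (SummableFamily.powerSeriesFamily g φ k) =
      (euler g • SummableFamily.powerSeriesFamily g
        (PowerSeries.derivative ℂ φ)).embDomain ⟨Nat.succ, Nat.succ_injective⟩ k := by
    intro k
    cases k with
    | zero =>
      rw [SummableFamily.embDomain_of_notMem_range (h := by simp)]
      rw [SummableFamily.powerSeriesFamily_of_orderTop_pos hg, pow_zero]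
      ext s
      by_cases h : s = 0 <;> simp [HahnSeries.coeff_one, h]
    | succ k =>
      rw [show k + 1 = (⟨Nat.succ, Nat.succ_injective⟩ : ℕ ↪ ℕ) k from rfl,
        SummableFamily.embDomain_image]
      simp only [Function.Embedding.coeFn_mk, Nat.succ_eq_add_one]
      rw [SummableFamily.smul_apply, SummableFamily.powerSeriesFamily_of_orderTop_pos hg,
        SummableFamily.powerSeriesFamily_of_orderTop_pos hg, PowerSeries.coeff_derivative]
      have := congrArg (fun x => PowerSeries.coeff (k + 1) φ • x) (euler_pow g k)
      refine Eq.trans ?_ (this.trans ?_)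
      · ext s; simp; ring
      · rw [smul_smul, of_symm_smul_of_eq_mul, ← C_mul_eq_smul, ← C_mul_eq_smul,
          mul_left_comm]
  rw [PowerSeries.heval_apply, PowerSeries.heval_apply, ← SummableFamily.hsum_smul,
    ← SummableFamily.hsum_embDomain
      (s := euler g • SummableFamily.powerSeriesFamily g (PowerSeries.derivative ℂ φ))
      (f := ⟨Nat.succ, Nat.succ_injective⟩)]
  ext s
  rw [coeff_euler, SummableFamily.coeff_hsum, SummableFamily.coeff_hsum, mul_finsum]
  · exact finsum_congr fun k => by rw [← key k, coeff_euler]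

/-- The differential equation of `(1 + X)^r`, resting on `(n + 1) choose(r, n + 1) = r choose(r - 1,
n)`. -/
theorem derivative_binomialSeries (r : ℂ) :
    (PowerSeries.derivative ℂ (PowerSeries.binomialSeries ℂ r)) * (1 + PowerSeries.X) =
      r • PowerSeries.binomialSeries ℂ r := by
  have h1 : PowerSeries.derivative ℂ (PowerSeries.binomialSeries ℂ r) =
      r • PowerSeries.binomialSeries ℂ (r - 1) := by
    ext n
    rw [PowerSeries.coeff_derivative]
    simp only [PowerSeries.binomialSeries_coeff, map_smul, smul_eq_mul, mul_one]
    have := Ring.choose_smul_choose r (Nat.le_add_left 1 n)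
    simpa [mul_comm] using this
  have h2 : PowerSeries.binomialSeries ℂ (1 : ℂ) = 1 + PowerSeries.X := by
    simpa using PowerSeries.binomialSeries_nat (A := ℂ) (R := ℂ) 1
  rw [h1, ← h2, smul_mul_assoc, ← PowerSeries.binomialSeries_add, sub_add_cancel]


theorem binomialSeries_one :
    PowerSeries.binomialSeries ℂ (1 : ℂ) = 1 + PowerSeries.X := by
  simpa using PowerSeries.binomialSeries_nat (A := ℂ) (R := ℂ) 1

/-- The part `1 + g(D)` of `f(D) = c D^d (1 + g(D))`. -/
def unitPart (f : ArtinianOp) : ArtinianOp := single (-f.order) f.leadingCoeff⁻¹ * f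

theorem single_mul_unitPart {f : ArtinianOp} (hf : f ≠ 0) :
    single f.order f.leadingCoeff * unitPart f = f := by
  rw [unitPart, ← mul_assoc, single_mul_single, add_neg_cancel,
    mul_inv_cancel₀ (leadingCoeff_ne_zero.2 hf), single_zero_one, one_mul]

theorem unitPart_sub_one_orderTop_pos {f : ArtinianOp} (hf : f ≠ 0) :
    0 < (unitPart f - 1).orderTop := by
  have hc := leadingCoeff_ne_zero.2 hf
  rw [orderTop_self_sub_one_pos_iff]
  have hs : single (-f.order) f.leadingCoeff⁻¹ ≠ (0 : ArtinianOp) := by simpa using hc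
  have h0 : unitPart f ≠ 0 := mul_ne_zero hs hf
  constructor
  · rw [unitPart, orderTop_mul, orderTop_single (inv_ne_zero hc), ← order_eq_orderTop_of_ne_zero hf,
      ← WithTop.coe_add, neg_add_cancel, WithTop.coe_zero]
  · rw [unitPart, leadingCoeff_mul, leadingCoeff_of_single, inv_mul_cancel₀ hc]

/-- Substitution into a power series is an algebra homomorphism, so identities of binomial series
transfer to generalized powers. -/
theorem genPow_eq (f : ArtinianOp) (b : ℝ) (n : ℤ) :
    genPow f b n = single (b * f.order)
      (Complex.exp (b * (Complex.log f.leadingCoeff + 2 * Real.pi * Complex.I * n))) *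
      PowerSeries.heval (unitPart f - 1) (PowerSeries.binomialSeries ℂ (b : ℂ)) := rfl

theorem genPow_add (f : ArtinianOp) (b b' : ℝ) (n : ℤ) :
    genPow f (b + b') n = genPow f b n * genPow f b' n := by
  rw [genPow_eq, genPow_eq, genPow_eq, mul_mul_mul_comm, single_mul_single, ← map_mul,
    ← PowerSeries.binomialSeries_add, ← Complex.exp_add, ← add_mul]
  push_cast
  rw [← add_mul]

theorem genPow_zero (f : ArtinianOp) (n : ℤ) : genPow f 0 n = 1 := by
  rw [genPow_eq, Complex.ofReal_zero, PowerSeries.binomialSeries_zero, map_one]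
  simp

theorem genPow_one {f : ArtinianOp} (hf : f ≠ 0) (n : ℤ) : genPow f 1 n = f := by
  rw [genPow_eq, Complex.ofReal_one, binomialSeries_one, map_add, map_one,
    PowerSeries.heval_X _ (unitPart_sub_one_orderTop_pos hf), add_sub_cancel, one_mul, one_mul,
    Complex.exp_add, Complex.exp_log (leadingCoeff_ne_zero.2 hf), mul_comm _ (n : ℂ),
    Complex.exp_int_mul_two_pi_mul_I, mul_one, single_mul_unitPart hf]

theorem genPow_ne_zero (f : ArtinianOp) (b : ℝ) (n : ℤ) : genPow f b n ≠ 0 := by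
  intro h
  have := genPow_add f b (-b) n
  rw [add_neg_cancel, genPow_zero, h, zero_mul] at this
  exact one_ne_zero this

theorem euler_eq_unitPart {f : ArtinianOp} (hf : f ≠ 0) :
    euler f = (f.order : ℂ) • f + single f.order f.leadingCoeff * euler (unitPart f) := by
  conv_lhs => rw [← single_mul_unitPart hf, euler_mul, euler_single, ← C_mul_eq_smul, mul_assoc,
    single_mul_unitPart hf, C_mul_eq_smul]

/-- The logarithmic derivative `E(f^b) / f^b = b E f / f`, cleared of denominators. The monomial
factor is an eigenvector of `E`; the unit part obeys the binomial differential equation. -/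
theorem euler_genPow_mul {f : ArtinianOp} (hf : f ≠ 0) (b : ℝ) (n : ℤ) :
    euler (genPow f b n) * f = (b : ℂ) • (genPow f b n * euler f) := by
  have hu := unitPart_sub_one_orderTop_pos hf
  have h1 : unitPart f = PowerSeries.heval (unitPart f - 1) (1 + PowerSeries.X) := by
    rw [map_add, map_one, PowerSeries.heval_X _ hu, add_sub_cancel]
  have h2 := euler_sub_one (unitPart f)
  have h3 : euler (PowerSeries.heval (unitPart f - 1) (PowerSeries.binomialSeries ℂ (b : ℂ))) *
      unitPart f = (b : ℂ) • (euler (unitPart f) *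
        PowerSeries.heval (unitPart f - 1) (PowerSeries.binomialSeries ℂ (b : ℂ))) := by
    rw [euler_heval _ hu, mul_assoc, h2]
    nth_rewrite 3 [h1]
    rw [← map_mul, derivative_binomialSeries, map_smul, ← C_mul_eq_smul,
      mul_left_comm, C_mul_eq_smul]
  have h4 := euler_eq_unitPart hf
  rw [genPow_eq, h4, euler_mul, euler_single]
  simp only [← C_mul_eq_smul] at h3 ⊢
  push_cast
  simp only [map_mul]
  generalize PowerSeries.heval (unitPart f - 1) (PowerSeries.binomialSeries ℂ (b : ℂ)) = U at *
  have h5 := (single_mul_unitPart hf).symm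
  linear_combination (single (b * f.order) (Complex.exp (b * (Complex.log f.leadingCoeff +
    2 * Real.pi * Complex.I * n)))) * (single f.order f.leadingCoeff * h3 + euler U * h5)

/-- `f(D)^b E f(D) = E (f(D)^(b+1)) / (b + 1)` for the Euler operator `E`. -/
theorem euler_genPow {f : ArtinianOp} (hf : f ≠ 0) (b : ℝ) (n : ℤ) :
    euler (genPow f (b + 1) n) = ((b : ℂ) + 1) • (genPow f b n * euler f) := by
  have h := euler_genPow_mul hf (b + 1) n
  apply mul_right_cancel₀ hf
  rw [h, genPow_add, genPow_one hf]
  simp only [← C_mul_eq_smul]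
  push_cast
  ring

/-- With `f = c D^d u`, the quotient `E f / f` is `d + u⁻¹ E (u - 1)`, and the second term has
positive order. -/
theorem coeff_zero_genPow_neg_one_mul_euler {f : ArtinianOp} (hf : f ≠ 0) (n : ℤ) :
    (genPow f (-1) n * euler f).coeff 0 = f.order := by
  have hu := unitPart_sub_one_orderTop_pos hf
  have h2 := euler_sub_one (unitPart f)
  have h0 : genPow f (-1) n * f = 1 := by
    nth_rewrite 2 [← genPow_one hf n]
    rw [← genPow_add, neg_add_cancel, genPow_zero]
  have hu0 : unitPart f ≠ 0 := by
    intro h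
    apply hf
    rw [← single_mul_unitPart hf, h, mul_zero]
  have h4 := euler_eq_unitPart hf
  have h5 : genPow f (-1) n * euler f = (f.order : ℂ) • (1 : ArtinianOp) +
      (unitPart f)⁻¹ * euler (unitPart f - 1) := by
    rw [h4, mul_add, ← C_mul_eq_smul, mul_left_comm, h0, C_mul_eq_smul, ← h2, ← mul_assoc]
    congr 2
    apply mul_right_cancel₀ hu0
    rw [mul_assoc, single_mul_unitPart hf, h0, inv_mul_cancel₀ hu0]
  have h6 : 0 < ((unitPart f)⁻¹ * euler (unitPart f - 1)).orderTop := by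
    have h7 : (unitPart f).orderTop = 0 := ((orderTop_self_sub_one_pos_iff _).1 hu).1
    have h8 : (unitPart f)⁻¹.orderTop = 0 := by
      have := orderTop_mul (unitPart f) (unitPart f)⁻¹
      rw [mul_inv_cancel₀ hu0, h7, zero_add, orderTop_one] at this
      exact this.symm
    rw [orderTop_mul, h8, zero_add]
    refine lt_of_lt_of_le hu ?_
    rw [le_orderTop_iff_forall]
    intro y hy
    rw [coeff_euler, coeff_eq_zero_of_lt_orderTop hy, mul_zero]
  rw [h5, coeff_add, coeff_smul, HahnSeries.coeff_one, if_pos rfl,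
    coeff_eq_zero_of_lt_orderTop (by simpa using h6)]
  simp

/-- `E` multiplies the constant term by zero, and for `b ≠ -1` the series is a multiple of an image
of `E`. -/
theorem coeff_zero_genPow_mul_euler {f : ArtinianOp} (hf : f ≠ 0) {b : ℝ} (hb : b ≠ -1)
    (n : ℤ) : (genPow f b n * euler f).coeff 0 = 0 := by
  have h := congrArg (fun x => HahnSeries.coeff x 0) (euler_genPow hf b n)
  have hb' : (b : ℂ) + 1 ≠ 0 := by
    rw [← Complex.ofReal_one, ← Complex.ofReal_add]
    exact_mod_cast fun h' => hb (by linarith)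
  simpa [hb'] using h.symm

/-- The series with exponents in an additive subgroup `G`. -/
def exponentSubring (G : AddSubgroup ℝ) : Subring ArtinianOp where
  carrier := {f | ∀ s ∈ f.support, s ∈ G}
  mul_mem' {f g} hf hg s hs := by
    obtain ⟨i, hi, j, hj, rfl⟩ := Set.mem_add.1 (support_mul_subset hs)
    exact G.add_mem (hf i hi) (hg j hj)
  add_mem' {f g} hf hg s hs := by
    rcases support_add_subset _ _ hs with h | h
    exacts [hf s h, hg s h]
  neg_mem' {f} hf s hs := hf s (by simpa using hs)
  one_mem' s hs := by
    have : s = 0 := by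
      by_contra h
      simp [h] at hs
    exact this ▸ G.zero_mem
  zero_mem' s hs := by simp at hs

theorem single_mem_exponentSubring {G : AddSubgroup ℝ} {s : ℝ} (hs : s ∈ G) (c : ℂ) :
    single s c ∈ exponentSubring G := by
  intro t ht
  have : t = s := support_single_subset ht
  exact this ▸ hs

theorem euler_mem_exponentSubring {G : AddSubgroup ℝ} {f : ArtinianOp}
    (hf : f ∈ exponentSubring G) : euler f ∈ exponentSubring G :=
  fun s hs => hf s (support_euler_subset f hs)

theorem heval_mem_exponentSubring {G : AddSubgroup ℝ} {g : ArtinianOp}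
    (hg : g ∈ exponentSubring G) (h0 : 0 < g.orderTop) (φ : PowerSeries ℂ) :
    PowerSeries.heval g φ ∈ exponentSubring G := by
  intro s hs
  rw [PowerSeries.heval_apply] at hs
  obtain ⟨k, hk⟩ := Set.mem_iUnion.1 (SummableFamily.support_hsum_subset hs)
  rw [SummableFamily.powerSeriesFamily_of_orderTop_pos h0] at hk
  refine pow_mem hg k s fun h => hk ?_
  rw [coeff_smul, h, smul_zero]

theorem genPow_mem_exponentSubring {G : AddSubgroup ℝ} {f : ArtinianOp} (hf : f ≠ 0)
    (hfG : f ∈ exponentSubring G) {b : ℝ} (hb : b * f.order ∈ G) (n : ℤ) :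
    genPow f b n ∈ exponentSubring G := by
  have ho : f.order ∈ G := hfG _ (by simpa using leadingCoeff_ne_zero.2 hf)
  rw [genPow_eq]
  refine mul_mem (single_mem_exponentSubring hb _) (heval_mem_exponentSubring
    (sub_mem (mul_mem (single_mem_exponentSubring (neg_mem ho) _) hfG) (one_mem _))
    (unitPart_sub_one_orderTop_pos hf) _)

/-! ### Arithmetic of Roman factorials -/

theorem romanFactorial_negInt (m : ℕ) :
    romanFactorial (-((m : ℝ) + 1)) = (-1) ^ m / (m.factorial : ℝ) := by
  have h : IsNegInt (-((m : ℝ) + 1)) := ⟨m, rfl⟩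
  have h2 : h.choose = m := by
    have := h.choose_spec
    have h3 : (m : ℝ) = h.choose := by linarith
    exact_mod_cast h3.symm
  rw [romanFactorial, dif_pos h, h2]

theorem romanFactorial_of_not_isNegInt {a : ℝ} (h : ¬ IsNegInt a) :
    romanFactorial a = Real.Gamma (a + 1) := dif_neg h

theorem romanFactorial_ne_zero (a : ℝ) : romanFactorial a ≠ 0 := by
  by_cases h : IsNegInt a
  · obtain ⟨m, rfl⟩ := h
    rw [romanFactorial_negInt]
    positivity
  · rw [romanFactorial_of_not_isNegInt h]
    refine Real.Gamma_ne_zero fun m hm => h ⟨m, by linarith⟩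

/-- At `a = -1` the left side would be 1 and the right side 0. -/
theorem romanFactorial_add_one {a : ℝ} (ha : a ≠ -1) :
    romanFactorial (a + 1) = (a + 1) * romanFactorial a := by
  by_cases h : IsNegInt a
  · obtain ⟨m, rfl⟩ := h
    cases m with
    | zero => simp at ha
    | succ k =>
      have : -(((k + 1 : ℕ) : ℝ) + 1) + 1 = -((k : ℝ) + 1) := by push_cast; ring
      rw [this, romanFactorial_negInt, romanFactorial_negInt, Nat.factorial_succ]
      push_cast
      have := Nat.factorial_ne_zero k
      field_simp
      ring
  · have h' : ¬ IsNegInt (a + 1) := by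
      rintro ⟨m, hm⟩
      exact h ⟨m + 1, by push_cast; linarith⟩
    rw [romanFactorial_of_not_isNegInt h, romanFactorial_of_not_isNegInt h',
      Real.Gamma_add_one fun h0 => ha (by linarith)]

theorem not_isNegInt_zero : ¬ IsNegInt 0 := by
  rintro ⟨m, hm⟩
  have : (0 : ℝ) ≤ m := Nat.cast_nonneg m
  linarith

/-! ### Coefficients of harmonic logarithms -/

theorem harmonicCoeff_zero (b : ℝ) :
    harmonicCoeff b 0 = (romanFactorial b : ℂ) * (Complex.Gamma (1 + b))⁻¹ := by
  simp [harmonicCoeff]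

theorem harmonicCoeff_zero_of_isNegInt {b : ℝ} (h : IsNegInt b) : harmonicCoeff b 0 = 0 := by
  obtain ⟨m, rfl⟩ := h
  rw [harmonicCoeff_zero]
  have : (1 : ℂ) + ((-((m : ℝ) + 1) : ℝ) : ℂ) = -m := by push_cast; ring
  rw [this, Complex.Gamma_neg_nat_eq_zero, inv_zero, mul_zero]

theorem harmonicCoeff_zero_ne_zero {b : ℝ} (h : ¬ IsNegInt b) : harmonicCoeff b 0 ≠ 0 := by
  rw [harmonicCoeff_zero]
  refine mul_ne_zero (by exact_mod_cast romanFactorial_ne_zero b) (inv_ne_zero ?_)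
  refine Complex.Gamma_ne_zero fun m hm => h ⟨m, ?_⟩
  have : 1 + b = -(m : ℝ) := by exact_mod_cast hm
  linarith

/-- The entire function `1 / Γ` has simple zeros at the nonpositive integers. This makes `γ_1(b)`
nonzero at negative integers `b`, where `γ_0(b)` vanishes. -/
theorem exists_inv_Gamma_sub_natCast_eq (m : ℕ) : ∃ Q : ℂ → ℂ, Differentiable ℂ Q ∧ Q 0 ≠ 0 ∧
    ∀ y, (Complex.Gamma (y - m))⁻¹ = Q y * y := by
  induction m with
  | zero =>
    refine ⟨fun y => (Complex.Gamma (y + 1))⁻¹, ?_, by simp, fun y => ?_⟩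
    · exact Complex.differentiable_one_div_Gamma.comp (differentiable_id.add_const 1)
    · rw [Nat.cast_zero, sub_zero, Complex.one_div_Gamma_eq_self_mul_one_div_Gamma_add_one,
        mul_comm]
  | succ m ih =>
    obtain ⟨Q, h1, h2, h3⟩ := ih
    refine ⟨fun y => (y - (m + 1)) * Q y, by fun_prop, ?_, fun y => ?_⟩
    · refine mul_ne_zero ?_ h2
      rw [zero_sub]
      exact neg_ne_zero.2 (Nat.cast_add_one_ne_zero m)
    · rw [Complex.one_div_Gamma_eq_self_mul_one_div_Gamma_add_one]
      have : y - ((m + 1 : ℕ) : ℂ) + 1 = y - m := by push_cast; ring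
      rw [this, h3]
      push_cast
      ring

theorem harmonicCoeff_one_ne_zero {b : ℝ} (h : IsNegInt b) : harmonicCoeff b 1 ≠ 0 := by
  obtain ⟨m, rfl⟩ := h
  obtain ⟨Q, h1, h2, h3⟩ := exists_inv_Gamma_sub_natCast_eq m
  rw [harmonicCoeff, iteratedDeriv_one, Nat.factorial_one, Nat.cast_one, div_one]
  refine mul_ne_zero (by exact_mod_cast romanFactorial_ne_zero _) ?_
  have h4 : (fun y : ℂ => Complex.Gamma (1 + y) *
      (Complex.Gamma (1 + ((-((m : ℝ) + 1) : ℝ) : ℂ) + y))⁻¹) =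
      fun y => Complex.Gamma (1 + y) * (Q y * y) := by
    funext y
    rw [← h3]
    congr 3
    push_cast
    ring
  have h5 : DifferentiableAt ℂ (fun y : ℂ => Complex.Gamma (1 + y)) 0 := by
    refine DifferentiableAt.comp (g := Complex.Gamma) 0 ?_ (by fun_prop)
    refine Complex.differentiableAt_Gamma _ fun k hk => ?_
    have h6 : (1 : ℝ) + 0 = -(k : ℝ) := by exact_mod_cast hk
    have : (0 : ℝ) ≤ k := Nat.cast_nonneg k
    linarith
  have h7 : HasDerivAt (fun y => Q y * y) (Q 0) 0 := by
    have := (h1 0).hasDerivAt.mul (hasDerivAt_id (0 : ℂ))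
    simp only [id, mul_zero, mul_one, zero_add] at this
    exact this
  have h8 := h5.hasDerivAt.mul h7
  simp only [mul_zero, zero_add, add_zero, Complex.Gamma_one, one_mul] at h8
  rw [h4, (show HasDerivAt (fun y => Complex.Gamma (1 + y) * (Q y * y)) (Q 0) 0 from h8).deriv]
  exact h2

theorem harmonicEntry_self (b : ℝ) (α : LogOrder) : harmonicEntry b α α = harmonicCoeff b 0 := by
  simp [harmonicEntry]

theorem harmonicEntry_zero_self (α : LogOrder) : harmonicEntry 0 α α = 1 := by
  rw [harmonicEntry_self, harmonicCoeff_zero, romanFactorial_of_not_isNegInt not_isNegInt_zero]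
  simp

theorem harmonicEntry_zero_of_isNegInt {b : ℝ} (h : IsNegInt b) (β : LogOrder) :
    harmonicEntry b 0 β = 0 := by
  rw [harmonicEntry]
  cases (((0 : LogOrder) 0) - β 0).toNat with
  | zero => rw [harmonicCoeff_zero_of_isNegInt h, zero_mul]
  | succ k =>
    rw [pow_succ, Module.End.mul_apply]
    simp [theta, thetaMono]

/-- The summands of `θ ℓ^α` carry pairwise distinct monomials, so none cancel. -/
theorem exists_theta_single_ne_zero {α : LogOrder} (hα : α ≠ 0) :
    ∃ β : LogOrder, theta (Finsupp.single α 1) β ≠ 0 := by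
  obtain ⟨i, hi⟩ := Finsupp.ne_iff.1 hα
  have hinj : ∀ j, α - ∑ l ∈ Finset.range (j + 1), Finsupp.single l (1 : ℤ) =
      α - ∑ l ∈ Finset.range (i + 1), Finsupp.single l (1 : ℤ) → j = i := by
    intro j hj
    have h1 : ∀ k l : ℕ, (∑ l ∈ Finset.range (k + 1), Finsupp.single l (1 : ℤ)) l =
        if l < k + 1 then 1 else 0 := by
      intro k l
      simp [Finsupp.finsetSum_apply, Finsupp.single_apply]
    have h2 := sub_right_injective hj
    have h3 := DFunLike.congr_fun h2 i
    have h4 := DFunLike.congr_fun h2 j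
    rw [h1, h1] at h3 h4
    by_contra hne
    rcases Nat.lt_or_gt_of_ne hne with h | h
    · simp [show ¬ i < j + 1 by omega] at h3
    · simp [show ¬ j < i + 1 by omega] at h4
  refine ⟨α - ∑ l ∈ Finset.range (i + 1), Finsupp.single l (1 : ℤ), ?_⟩
  rw [theta, Finsupp.linearCombination_single, one_smul, thetaMono, Finsupp.finsetSum_apply,
    Finset.sum_eq_single i]
  · rw [Finsupp.single_eq_same]
    exact_mod_cast hi
  · intro j _ hj
    exact Finsupp.single_eq_of_ne fun h => hj (hinj j h.symm)
  · intro h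
    exact absurd (Finsupp.mem_support_iff.2 hi) h

/-- The witness is the `ℓ^α` term when `γ_0(b) ≠ 0`, and otherwise a monomial of `γ_1(b) θ ℓ^α`. -/
theorem exists_harmonicEntry_ne_zero {b : ℝ} {α : LogOrder} (h : α = 0 → ¬ IsNegInt b) :
    ∃ β, harmonicEntry b α β ≠ 0 := by
  by_cases hb : IsNegInt b
  · obtain ⟨β, hβ⟩ := exists_theta_single_ne_zero fun h0 => h h0 hb
    have h0 := theta_pow_apply_ne_zero α 1 β (by simpa using hβ)
    refine ⟨β, ?_⟩
    have h1 : (α 0 - β 0).toNat = 1 := by rw [h0]; simp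
    rw [harmonicEntry, h1, pow_one]
    exact mul_ne_zero (harmonicCoeff_one_ne_zero hb) hβ
  · exact ⟨α, by rw [harmonicEntry_self]; exact harmonicCoeff_zero_ne_zero hb⟩

/-! ### Expansions in harmonic logarithms -/

theorem coeff_harmonicSum_mono (α : LogOrder) (c : Noeth) (b : ℝ) (β : LogOrder) :
    (harmonicSum α c).coeff (mono b β) =
      c.coeff (OrderDual.toDual b) * harmonicEntry b α β := rfl

theorem harmonicSum_eq_iff {α : LogOrder} {c d : Noeth} :
    harmonicSum α c = harmonicSum α d ↔ ∀ b : ℝ, (α = 0 → ¬ IsNegInt b) →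
      c.coeff (OrderDual.toDual b) = d.coeff (OrderDual.toDual b) := by
  constructor
  · intro h b hb
    obtain ⟨β, hβ⟩ := exists_harmonicEntry_ne_zero hb
    have := congrArg (fun x => HahnSeries.coeff x (mono b β)) h
    simpa only [coeff_harmonicSum_mono, mul_left_inj' hβ] using this
  · intro h
    ext m
    by_cases hm : α = 0 → ¬ IsNegInt (xExp m)
    · exact congrArg (· * _) (h _ hm)
    · push Not at hm
      obtain ⟨rfl, hm⟩ := hm
      simp only [harmonicSum, harmonicEntry_zero_of_isNegInt hm, mul_zero]

open Classical in
theorem exists_isExpansion (α : LogOrder) (c : Noeth) :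
    ∃ d, IsExpansion α (harmonicSum α c) d := by
  refine ⟨⟨fun b => if α = 0 ∧ IsNegInt (OrderDual.ofDual b) then 0 else c.coeff b, ?_⟩, ?_, ?_⟩
  · refine c.isPWO_support.mono fun b hb h0 => hb ?_
    simp [h0]
  · refine harmonicSum_eq_iff.2 fun b hb => ?_
    have : ¬ (α = 0 ∧ IsNegInt b) := fun h => hb h.1 h.2
    simp [this]
  · intro h0 a ha
    simp [h0, ha]

theorem isExpansion_expansion (α : LogOrder) (c : Noeth) :
    IsExpansion α (harmonicSum α c) (expansion α (harmonicSum α c)) := by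
  have h := exists_isExpansion α c
  rw [expansion, dif_pos h]
  exact h.choose_spec

theorem coeff_expansion_harmonicSum {α : LogOrder} (c : Noeth) {b : ℝ}
    (hb : α = 0 → ¬ IsNegInt b) :
    (expansion α (harmonicSum α c)).coeff (OrderDual.toDual b) = c.coeff (OrderDual.toDual b) :=
  (harmonicSum_eq_iff.1 (isExpansion_expansion α c).1 b hb).symm

/-- For `α = 0` the chosen expansion may differ from `c` only at negative integer degrees. A
differential operator lowers degrees by natural numbers, so these coefficients reach only negative
integer degrees, where `λ_b^(0) = 0`. -/
theorem act_harmonicSum {α : LogOrder} {f : ArtinianOp} (hf : α = 0 → IsDifferential f)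
    (c : Noeth) : act α f (harmonicSum α c) = harmonicSum α (actCoeff f c) := by
  refine harmonicSum_eq_iff.2 fun b hb => ?_
  refine finsum_congr fun s => ?_
  by_cases hs : f.coeff s = 0
  · simp [hs]
  · simp only [OrderDual.ofDual_toDual]
    rw [coeff_expansion_harmonicSum]
    intro h0 hneg
    obtain ⟨k, rfl⟩ := hf h0 s hs
    obtain ⟨m, hm⟩ := hneg
    exact hb h0 ⟨m + k, by push_cast; linarith⟩

theorem coeff_shiftCoeff_zero (c : Noeth) :
    (shiftCoeff c).coeff (OrderDual.toDual 0) = 0 := if_pos rfl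

theorem coeff_shiftCoeff_of_ne (c : Noeth) {b : ℝ} (hb : b ≠ 0) :
    (shiftCoeff c).coeff (OrderDual.toDual b) = c.coeff (OrderDual.toDual (b - 1)) := if_neg hb

theorem romanShift_harmonicSum (α : LogOrder) (c : Noeth) :
    romanShift α (harmonicSum α c) = harmonicSum α (shiftCoeff c) := by
  refine harmonicSum_eq_iff.2 fun b hb => ?_
  -- Degree `-1` is the only negative integer that would leave the negative integers, and `σ` sends
  -- it to zero.
  by_cases h : b = 0
  · rw [h, coeff_shiftCoeff_zero, coeff_shiftCoeff_zero]
  · rw [coeff_shiftCoeff_of_ne _ h, coeff_shiftCoeff_of_ne _ h, coeff_expansion_harmonicSum]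
    intro h0 hneg
    obtain ⟨m, hm⟩ := hneg
    cases m with
    | zero => exact h (by push_cast at hm; linarith)
    | succ k => exact hb h0 ⟨k, by push_cast at hm; linarith⟩

/-! ### Passing to series in `D` -/

/-- The series `∑ a, c_a ⌊a⌉! T^(-a)` in which Artinian operators act by multiplication. -/
def toOp (c : Noeth) : ArtinianOp where
  coeff s := c.coeff (OrderDual.toDual (-s)) * (romanFactorial (-s) : ℂ)
  isPWO_support' := by
    refine (c.isPWO_support.image_of_monotone (f := fun a : ℝᵒᵈ => -OrderDual.ofDual a)
      fun s t h => ?_).mono ?_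
    · exact neg_le_neg (OrderDual.ofDual_le_ofDual.2 h)
    · intro s hs
      exact ⟨OrderDual.toDual (-s), left_ne_zero_of_mul hs, by simp⟩

theorem coeff_toOp (c : Noeth) (s : ℝ) :
    (toOp c).coeff s = c.coeff (OrderDual.toDual (-s)) * (romanFactorial (-s) : ℂ) := rfl

theorem toOp_injective : Function.Injective toOp := by
  intro c d h
  ext b
  have := congrArg (fun x => HahnSeries.coeff x (-OrderDual.ofDual b)) h
  simpa [coeff_toOp, romanFactorial_ne_zero] using this

theorem coeff_mul_eq_finsum (f g : ArtinianOp) (t : ℝ) :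
    (f * g).coeff t = ∑ᶠ s, f.coeff s * g.coeff (t - s) := by
  rw [coeff_mul]
  refine Eq.trans ?_ (finsum_eq_sum_of_support_subset (s := (Finset.antidiagonal f.isPWO_support
    g.isPWO_support t).image Prod.fst) _ ?_).symm
  · rw [Finset.sum_image]
    · refine Finset.sum_congr rfl fun ij hij => ?_
      rw [← (Finset.mem_antidiagonal.1 hij).2.2, add_sub_cancel_left]
    · intro i hi j hj hij
      have h1 := (Finset.mem_antidiagonal.1 hi).2.2
      have h2 := (Finset.mem_antidiagonal.1 hj).2.2
      exact Prod.ext hij (by linarith)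
  · intro s hs
    rw [Finset.coe_image]
    exact ⟨(s, t - s), Finset.mem_antidiagonal.2 ⟨left_ne_zero_of_mul hs,
      right_ne_zero_of_mul hs, by simp⟩, rfl⟩

theorem toOp_actCoeff (f : ArtinianOp) (c : Noeth) : toOp (actCoeff f c) = f * toOp c := by
  ext t
  rw [coeff_mul_eq_finsum, coeff_toOp]
  have h0 : (romanFactorial (-t) : ℂ) ≠ 0 := by exact_mod_cast romanFactorial_ne_zero _
  rw [actCoeff]
  simp only [OrderDual.ofDual_toDual]
  rw [finsum_mul]
  refine finsum_congr fun s => ?_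
  rw [coeff_toOp, neg_sub, neg_add_eq_sub]
  push_cast
  field_simp

/-- The factor comes from `⌊-s⌉! = -s ⌊-s-1⌉!`. Its vanishing at `s = 0` matches `σ λ_{-1} = 0`. -/
theorem coeff_toOp_shiftCoeff (c : Noeth) (s : ℝ) :
    (toOp (shiftCoeff c)).coeff s = -(s : ℂ) * (toOp c).coeff (s + 1) := by
  rw [coeff_toOp, coeff_toOp]
  by_cases h : -s = 0
  · rw [neg_eq_zero.1 h, neg_zero, coeff_shiftCoeff_zero]
    simp
  · rw [coeff_shiftCoeff_of_ne _ h]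
    have h1 : -(s + 1) = -s - 1 := by ring
    have h2 := romanFactorial_add_one (a := -s - 1) fun h' => h (by linarith)
    rw [sub_add_cancel] at h2
    rw [h2, h1]
    push_cast
    ring

/-! ### Associated graded sequences -/

theorem augmentation_harmonicSum (α : LogOrder) (c : Noeth) :
    augmentation α (harmonicSum α c) = (toOp c).coeff 0 := by
  rw [augmentation, coeff_harmonicSum_mono, harmonicEntry_zero_self, coeff_toOp, neg_zero,
    romanFactorial_of_not_isNegInt not_isNegInt_zero]
  simp

theorem toOp_shiftCoeff (c : Noeth) :
    toOp (shiftCoeff c) = -euler (single (-1) 1 * toOp c) := by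
  ext s
  have h : (single (-1 : ℝ) (1 : ℂ) * toOp c).coeff (s + 1 + -1) = (toOp c).coeff (s + 1) := by
    rw [coeff_single_mul_add, one_mul]
  rw [add_neg_cancel_right] at h
  rw [coeff_toOp_shiftCoeff, coeff_neg, coeff_euler, h, neg_mul]

/-! ### Pincherle derivatives and differential operators -/

theorem single_mul_pincherle (f : ArtinianOp) : single 1 1 * pincherle f = euler f := by
  ext s
  have h : (single (1 : ℝ) (1 : ℂ) * pincherle f).coeff (s - 1 + 1) =
      (pincherle f).coeff (s - 1) := by
    rw [coeff_single_mul_add, one_mul]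
  rw [sub_add_cancel] at h
  rw [h, coeff_euler, pincherle]
  simp

theorem IsDelta.ne_zero {f : ArtinianOp} (hf : IsDelta f) : f ≠ 0 := by
  rintro rfl
  simp [IsDelta] at hf

theorem IsDelta.order_eq {f : ArtinianOp} (hf : IsDelta f) : f.order = 1 := by
  have := order_eq_orderTop_of_ne_zero hf.ne_zero
  rw [hf] at this
  exact_mod_cast this

theorem IsDelta.coeff_one_ne_zero {f : ArtinianOp} (hf : IsDelta f) : f.coeff 1 ≠ 0 := by
  have h := leadingCoeff_ne_zero.2 hf.ne_zero
  rwa [leadingCoeff_eq, hf.order_eq] at h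

theorem coeff_pincherle_zero (f : ArtinianOp) : (pincherle f).coeff 0 = f.coeff 1 := by
  simp [pincherle]

theorem pincherle_ne_zero {f : ArtinianOp} (hf : IsDelta f) : pincherle f ≠ 0 := by
  intro h
  apply hf.coeff_one_ne_zero
  rw [← coeff_pincherle_zero, h, coeff_zero]

theorem isDifferential_pincherle {f : ArtinianOp} (hf : IsDifferential f) :
    IsDifferential (pincherle f) := by
  intro s hs
  obtain ⟨k, hk⟩ := hf (s + 1) (right_ne_zero_of_mul hs)
  cases k with
  | zero =>
    refine absurd ?_ (left_ne_zero_of_mul hs)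
    rw [hk]; simp
  | succ k => exact ⟨k, by push_cast at hk; linarith⟩

theorem IsDifferential.exists_powerSeries {f : ArtinianOp} (hf : IsDifferential f) :
    ∃ φ : PowerSeries ℂ, ofPowerSeries ℝ ℂ φ = f := by
  refine ⟨PowerSeries.mk fun k => f.coeff k, ?_⟩
  ext s
  by_cases h : ∃ k : ℕ, s = k
  · obtain ⟨k, rfl⟩ := h
    rw [ofPowerSeries_apply_coeff, PowerSeries.coeff_mk]
  · rw [ofPowerSeries_apply, embDomain_of_notMem_range]
    · by_contra h0
      exact h (hf s (Ne.symm h0))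
    · rintro ⟨k, hk⟩
      exact h ⟨k, hk.symm⟩

theorem isDifferential_ofPowerSeries (φ : PowerSeries ℂ) :
    IsDifferential (ofPowerSeries ℝ ℂ φ) := by
  intro s hs
  by_contra h
  refine hs ?_
  rw [ofPowerSeries_apply, embDomain_of_notMem_range]
  rintro ⟨k, hk⟩
  exact h ⟨k, hk.symm⟩

theorem IsDifferential.inv {f : ArtinianOp} (hf : IsDifferential f) (h0 : f.coeff 0 ≠ 0) :
    IsDifferential f⁻¹ := by
  obtain ⟨φ, rfl⟩ := hf.exists_powerSeries
  have h1 : PowerSeries.constantCoeff φ ≠ 0 := by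
    have := ofPowerSeries_apply_coeff (Γ := ℝ) φ 0
    rw [Nat.cast_zero, PowerSeries.coeff_zero_eq_constantCoeff_apply] at this
    rwa [← this]
  have h2 := congrArg (ofPowerSeries ℝ ℂ) (PowerSeries.mul_inv_cancel φ h1)
  rw [map_mul, map_one] at h2
  rw [inv_eq_of_mul_eq_one_right h2]
  exact isDifferential_ofPowerSeries _

/-- Series with exponents in `G` are separated by the powers of a delta operator. -/
theorem eq_zero_of_forall_coeff_zero_genPow_mul {G : AddSubgroup ℝ} {f : ArtinianOp}
    (hf : IsDelta f) (n : ℤ) {x : ArtinianOp} (hx : x ∈ exponentSubring G)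
    (h : ∀ b ∈ G, (genPow f b n * x).coeff 0 = 0) : x = 0 := by
  by_contra h0
  have hne := genPow_ne_zero f (-x.order) n
  have hxG : x.order ∈ G := hx _ (by simpa using leadingCoeff_ne_zero.2 h0)
  -- As `f` has order 1, `f^b` has order `b`. With `b = -x.order` the product has order 0, so its
  -- constant term is its nonzero leading coefficient.
  have h1 := h (-x.order) (G.neg_mem hxG)
  have h2 : (genPow f (-x.order) n).order = -x.order := by
    have h3 : (PowerSeries.heval (unitPart f - 1)
        (PowerSeries.binomialSeries ℂ ((-x.order : ℝ) : ℂ))).orderTop = 0 :=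
      ((orderTop_self_sub_one_pos_iff _).1 (SummableFamily.orderTop_hsum_binomialFamily_pos
        (unitPart_sub_one_orderTop_pos hf.ne_zero) _)).1
    have h4 := order_eq_orderTop_of_ne_zero hne
    have h5 : (genPow f (-x.order) n).orderTop = ((-x.order : ℝ) : WithTop ℝ) := by
      rw [genPow_eq, orderTop_mul, h3, orderTop_single (Complex.exp_ne_zero _), hf.order_eq,
        mul_one, add_zero]
    rw [h5] at h4
    exact_mod_cast h4
  have h6 := leadingCoeff_ne_zero.2 (mul_ne_zero hne h0)
  rw [leadingCoeff_eq, order_mul hne h0, h2, neg_add_cancel] at h6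
  exact h6 h1

/-- The coefficients of the associated graded sequence of a delta operator. -/
theorem toOp_eq_of_forall_coeff_zero {G : AddSubgroup ℝ} {f : ArtinianOp} (hf : IsDelta f)
    (hfG : f ∈ exponentSubring G) (h1 : (1 : ℝ) ∈ G) (n : ℤ) {a : ℝ} (ha : a ∈ G) {x : ArtinianOp}
    (hx : x ∈ exponentSubring G) (r : ℂ)
    (h : ∀ b ∈ G, (genPow f b n * x).coeff 0 = if a = b then r else 0) :
    x = r • (genPow f (-a - 1) n * euler f) := by
  rw [← sub_eq_zero]
  refine eq_zero_of_forall_coeff_zero_genPow_mul hf n (sub_mem hx ?_) fun b hb => ?_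
  · rw [← C_mul_eq_smul]
    refine mul_mem (single_mem_exponentSubring G.zero_mem r) (mul_mem ?_
      (euler_mem_exponentSubring hfG))
    refine genPow_mem_exponentSubring hf.ne_zero hfG ?_ n
    rw [hf.order_eq, mul_one]
    exact G.sub_mem (G.neg_mem ha) h1
  · have h2 : genPow f b n * (x - r • (genPow f (-a - 1) n * euler f)) =
        genPow f b n * x - r • (genPow f (b + (-a - 1)) n * euler f) := by
      rw [genPow_add]
      simp only [← C_mul_eq_smul]
      ring
    rw [h2, coeff_sub, h b hb, coeff_smul]
    split_ifs with hab
    · rw [hab, show b + (-b - 1) = -1 by ring, coeff_zero_genPow_neg_one_mul_euler hf.ne_zero,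
        hf.order_eq]
      simp
    · rw [coeff_zero_genPow_mul_euler hf.ne_zero fun h' => hab (by linarith)]
      simp

theorem IsAssociated.exists_toOp_eq {G : AddSubgroup ℝ} {f : ArtinianOp} (hf : IsDelta f)
    (hfG : f ∈ exponentSubring G) (h1 : (1 : ℝ) ∈ G) {n : ℤ} {p : ℝ → LogOrder → LogSeries}
    (hp : IsAssociated G f n p) {a : ℝ} (ha : a ∈ G) :
    ∃ c : Noeth, (∀ α, p a α = harmonicSum α c) ∧
      toOp c = (romanFactorial a : ℂ) • (genPow f (-a - 1) n * euler f) := by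
  obtain ⟨c, hc, -, hpc⟩ := hp.1 a ha
  refine ⟨c, hpc, toOp_eq_of_forall_coeff_zero hf hfG h1 n ha ?_ _ fun b hb => ?_⟩
  · intro s hs
    have := hc _ (left_ne_zero_of_mul hs)
    simpa using G.neg_mem this
  -- Any nonzero order will do: the coefficients `c` are common to all orders, so the formula also
  -- covers `α = 0`.
  · have hα : Finsupp.single 0 (1 : ℤ) ≠ (0 : LogOrder) := by simp
    have := hp.2 a ha b hb _ hα
    rwa [hpc, act_harmonicSum fun h => absurd h hα, augmentation_harmonicSum,
      toOp_actCoeff] at this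

end IterLog

end

/-! ### The recurrence formula -/

theorem mainTheorem9
    (G : AddSubgroup ℝ) (hG : G = AddSubgroup.zmultiples (1 : ℝ) ∨ G = ⊤)
    (f : IterLog.ArtinianOp) (hfG : ∀ s ∈ f.support, s ∈ G) (hf : IterLog.IsDelta f)
    (n : ℤ) (p : ℝ → IterLog.LogOrder → IterLog.LogSeries)
    (hp : IterLog.IsAssociated G f n p)
    (a : ℝ) (ha : a ∈ G) (ha1 : a ≠ -1) (α : IterLog.LogOrder)
    (hα : α = 0 → G = ⊤ → IterLog.IsDifferential f) :
    p (a + 1) α =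
      IterLog.romanShift α (IterLog.act α (IterLog.pincherle f)⁻¹ (p a α)) := by
  have h1 : (1 : ℝ) ∈ G := by
    rcases hG with rfl | rfl
    exacts [AddSubgroup.mem_zmultiples 1, AddSubgroup.mem_top _]
  have hdiff : α = 0 → IterLog.IsDifferential f := by
    intro h0
    rcases hG with rfl | rfl
    -- In the discrete theory all exponents are integers, and at least 1 because `f` is a delta
    -- operator.
    · intro s hs
      obtain ⟨k, hk⟩ := AddSubgroup.mem_zmultiples_iff.1 (hfG s hs)
      rw [zsmul_one] at hk
      have h2 : f.order ≤ s := HahnSeries.order_le_of_coeff_ne_zero hs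
      rw [hf.order_eq, ← hk] at h2
      have h3 : (1 : ℤ) ≤ k := by exact_mod_cast h2
      refine ⟨k.toNat, ?_⟩
      rw [← hk]
      have : ((k.toNat : ℤ) : ℝ) = k := by rw [Int.toNat_of_nonneg (by omega)]
      exact_mod_cast this.symm
    · exact hα h0 rfl
  have hinv : α = 0 → IterLog.IsDifferential (IterLog.pincherle f)⁻¹ := fun h0 =>
    (IterLog.isDifferential_pincherle (hdiff h0)).inv (by
      rw [IterLog.coeff_pincherle_zero]
      exact hf.coeff_one_ne_zero)
  obtain ⟨c, hc, hc'⟩ := hp.exists_toOp_eq hf hfG h1 ha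
  obtain ⟨d, hd, hd'⟩ := hp.exists_toOp_eq hf hfG h1 (G.add_mem ha h1)
  rw [hc, hd, IterLog.act_harmonicSum hinv, IterLog.romanShift_harmonicSum]
  congr 1
  apply IterLog.toOp_injective
  have hne := IterLog.pincherle_ne_zero hf
  -- `T⁻¹ (f')⁻¹` cancels `E f = T f'`. The exponent is written `-a - 2 + 1` so that `euler_genPow`
  -- applies with `b = -a - 2`; its factor `b + 1 = -(a + 1)` absorbs the sign of the shift.
  have h2 : HahnSeries.single (-1 : ℝ) (1 : ℂ) * ((IterLog.pincherle f)⁻¹ * IterLog.toOp c) =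
      (IterLog.romanFactorial a : ℂ) • IterLog.genPow f (-a - 2 + 1) n := by
    have h3 : HahnSeries.single (-1 : ℝ) (1 : ℂ) * HahnSeries.single (1 : ℝ) (1 : ℂ) = 1 := by
      rw [HahnSeries.single_mul_single, neg_add_cancel, one_mul, HahnSeries.single_zero_one]
    have h4 := mul_inv_cancel₀ hne
    rw [hc', ← IterLog.single_mul_pincherle, show -a - 2 + 1 = -a - 1 by ring]
    simp only [← HahnSeries.C_mul_eq_smul]
    linear_combination (HahnSeries.C (IterLog.romanFactorial a : ℂ) * IterLog.genPow f (-a - 1) n *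
      (IterLog.pincherle f)⁻¹ * IterLog.pincherle f) * h3 +
      (HahnSeries.C (IterLog.romanFactorial a : ℂ) * IterLog.genPow f (-a - 1) n) * h4
  rw [IterLog.toOp_shiftCoeff, IterLog.toOp_actCoeff, h2, hd', IterLog.romanFactorial_add_one ha1,
    show -(a + 1) - 1 = -a - 2 by ring]
  have h5 : ∀ (r : ℂ) (x : IterLog.ArtinianOp), IterLog.euler (r • x) = r • IterLog.euler x := by
    intro r x
    ext s
    simp [mul_left_comm]
  rw [h5, IterLog.euler_genPow hf.ne_zero]
  ext s
  simp only [HahnSeries.coeff_smul, HahnSeries.coeff_neg, smul_eq_mul]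
  push_cast
  ring
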